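/- Let $\mathbb{F}$ be the field of real Puiseux series, that is, of series $\sum_{k=-\infty}^{k_0} c_k X^{k/m}$ with $c_k\in\mathbb{R}$, $k_0,m\in\mathbb{Z}$, $m>0$ (including $0$), ordered such that $X$ is larger than every real number. For a positive $a=\sum_{k\le k_0} c_kX^{k/m}\in\mathbb{F}$ with $c_{k_0}\neq 0$ put $\log a := k_0/m\in\mathbb{Q}$. Let $\mathbb{H}_\mathbb{F}=\{x+iy \mid x,y\in\mathbb{F},\ y>0\}\subseteq\mathbb{F}[i]$, $i^2=-1$. For $z,z'\in\mathbb{H}_\mathbb{F}$ let $w,w'\in\mathbb{F}\cup\{\infty\}$ be the endpoints of an $\mathbb{F}$-line (vertical ray, or half-circle orthogonal to $\{y=0\}$) through $z$ and $z'$, named such that $w,z,z',w'$ appear in this order on the line, and put $$d(z,z') := \log \mathrm{CR}(w,z,z',w'),\qquad \mathrm{CR}(w,z,z',w')=\frac{(z'-w)(z-w')}{(z-w)(z'-w')},$$ where factors containing $\infty$ are omitted. This is a $\mathbb{Q}$-valued pseudo-distance on $\mathbb{H}_\mathbb{F}$. Let $\pi\colon\mathbb{H}_\mathbb{F}\to\mathcal{T}_\mathbb{F}:=\mathbb{H}_\mathbb{F}/\{d=0\}$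 be the projection to the quotient (Brumfiel's $\mathbb{Q}$-tree) with the induced distance. A segment of $\mathcal{T}_\mathbb{F}$ is the image of an isometric embedding of an interval $\{t\in\mathbb{Q}\mid a\le t\le b\}$ with rational numbers $a\le b$. Let $$\mathcal{T}_\mathbb{F}^{\mathrm{sc}} := \bigcup_{s \text{ segment in } \mathcal{T}_\mathbb{F}} \overline{s},$$ where $\overline{s}$ is the metric completion of $s$; the union is taken inside the metric completion of $\mathcal{T}_\mathbb{F}$ and carries its metric, and it contains $\mathcal{T}_\mathbb{F}$. **Theorem.** The metric space $\mathcal{T}_\mathbb{F}^{\mathrm{sc}}$ is not complete. More precisely, for $n\ge 0$ let $t_n=-1+2^{-n}$ and $p_n=\sum_{k=1}^n X^{t_k}+i\,X^{t_n}\in\mathbb{H}_\mathbb{F}$. Then $(\pi(p_n))_{n\ge 0}$ is a Cauchy sequence in $\mathcal{T}_\mathbb{F}$ that does not converge in $\mathcal{T}_\mathbb{F}^{\mathrm{sc}}$, that is, it converges to no point of the completion of any segment. -/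

import Mathlib

noncomputable section

namespace Puiseux

/-- The dilation `k ↦ k / m` of exponents as a ring homomorphism `ℝ((T)) → ℝ((T^ℚ))`,
`T ↦ T^(1/m)`. -/
def dilate (m : ℕ) (hm : 0 < m) : HahnSeries ℤ ℝ →+* HahnSeries ℚ ℝ :=
  HahnSeries.embDomainRingHom
    { toFun := fun k => (k : ℚ) / m
      map_zero' := by simp
      map_add' := fun a b => by push_cast; ring }
    (fun a b h => by
      have hm' : (m : ℚ) ≠ 0 := by positivity
      have h' : (a : ℚ) / m = (b : ℚ) / m := h
      field_simp at h'
      exact_mod_cast h')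
    (fun a b => by
      have hm' : (0 : ℚ) < m := by exact_mod_cast hm
      change (a : ℚ) / m ≤ (b : ℚ) / m ↔ a ≤ b
      rw [div_le_div_iff_of_pos_right hm']
      exact_mod_cast Iff.rfl)

/-- `a` has all its exponents in `(1/m)ℤ`. -/
def HasDenominator (m : ℕ) (a : HahnSeries ℚ ℝ) : Prop :=
  ∀ q ∈ a.support, ∃ k : ℤ, q = (k : ℚ) / m

theorem dilate_coeff (m : ℕ) (hm : 0 < m) (y : HahnSeries ℤ ℝ) (k : ℤ) :
    (dilate m hm y).coeff ((k : ℚ) / m) = y.coeff k :=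
  HahnSeries.embDomain_coeff

theorem dilate_single (m : ℕ) (hm : 0 < m) (k : ℤ) (c : ℝ) :
    dilate m hm (HahnSeries.single k c) = HahnSeries.single ((k : ℚ) / m) c :=
  HahnSeries.embDomain_single

theorem hasDenominator_dilate (m : ℕ) (hm : 0 < m) (y : HahnSeries ℤ ℝ) :
    HasDenominator m (dilate m hm y) := by
  intro q hq
  obtain ⟨k, -, rfl⟩ := HahnSeries.support_embDomain_subset hq
  exact ⟨k, rfl⟩

theorem exists_dilate (m : ℕ) (hm : 0 < m) (a : HahnSeries ℚ ℝ) (ha : HasDenominator m a) :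
    ∃ y, dilate m hm y = a := by
  have hm' : (0 : ℚ) < m := by exact_mod_cast hm
  have hpwo : (Function.support fun k : ℤ => a.coeff ((k : ℚ) / m)).IsPWO := by
    have h := a.isPWO_support
    rw [Set.isPWO_iff_isWF] at h ⊢
    have h2 := h
    rw [Set.IsWF, Set.wellFoundedOn_iff] at h2 ⊢
    refine Subrelation.wf ?_ (InvImage.wf (fun k : ℤ => (k : ℚ) / m) h2)
    rintro x y ⟨hxy, hx, hy⟩
    refine ⟨?_, hx, hy⟩
    change (x : ℚ) / m < (y : ℚ) / m
    rw [div_lt_div_iff_of_pos_right hm']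
    exact_mod_cast hxy
  refine ⟨⟨fun k => a.coeff ((k : ℚ) / m), hpwo⟩, ?_⟩
  · ext q
    by_cases hq : ∃ k : ℤ, q = (k : ℚ) / m
    · obtain ⟨k, rfl⟩ := hq
      rw [dilate_coeff]
    · have h1 : q ∉ a.support := fun h => hq (ha q h)
      have h2 : q ∉ (dilate m hm ⟨fun k => a.coeff ((k : ℚ) / m), hpwo⟩).support :=
        fun h => hq (hasDenominator_dilate m hm _ q h)
      rw [HahnSeries.mem_support, not_not] at h1 h2
      rw [h1, h2]

theorem HasDenominator.mul_right {m : ℕ} {a : HahnSeries ℚ ℝ} (h : HasDenominator m a)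
    (n : ℕ) (hn : 0 < n) : HasDenominator (m * n) a := by
  intro q hq
  obtain ⟨k, rfl⟩ := h q hq
  have : (n : ℚ) ≠ 0 := by positivity
  exact ⟨k * n, by push_cast; rw [mul_div_mul_right _ _ this]⟩

theorem HasDenominator.mul_left {m : ℕ} {a : HahnSeries ℚ ℝ} (h : HasDenominator m a)
    (n : ℕ) (hn : 0 < n) : HasDenominator (n * m) a := by
  rw [mul_comm]; exact h.mul_right n hn

/-- The underlying set of the field of real Puiseux series, see `puiseuxSubfield`. -/
def IsPuiseux (a : HahnSeries ℚ ℝ) : Prop := ∃ m : ℕ, 0 < m ∧ HasDenominator m a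

theorem isPuiseux_dilate (m : ℕ) (hm : 0 < m) (y : HahnSeries ℤ ℝ) :
    IsPuiseux (dilate m hm y) := ⟨m, hm, hasDenominator_dilate m hm y⟩

theorem exists_common_dilate {a b : HahnSeries ℚ ℝ} (ha : IsPuiseux a) (hb : IsPuiseux b) :
    ∃ (m : ℕ) (hm : 0 < m) (x y : HahnSeries ℤ ℝ), dilate m hm x = a ∧ dilate m hm y = b := by
  obtain ⟨m, hm, h⟩ := ha
  obtain ⟨n, hn, h'⟩ := hb
  obtain ⟨x, hx⟩ := exists_dilate (m * n) (Nat.mul_pos hm hn) a (h.mul_right n hn)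
  obtain ⟨y, hy⟩ := exists_dilate (m * n) (Nat.mul_pos hm hn) b (h'.mul_left m hm)
  exact ⟨_, _, x, y, hx, hy⟩

/-- The field of real Puiseux series `∑_{k ≤ k₀} c_k X^(k/m)`, as an ordered subfield of the Hahn
series with exponents in `ℚ`. Hahn series have well-ordered support, whereas the series here
are infinite in the direction of the negative powers of `X`; so the Hahn series variable is `X⁻¹`,
that is, the coefficient of `X^q` is `a.coeff (-q)`. A well-ordered subset of `(1/m)ℤ` is the
same thing as a subset that is bounded below.
The order inherited from `Lex` is the one in which a series is positive when the coefficient of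
its highest power of `X` is positive; so `X` is larger than every real number. -/
def puiseuxSubfield : Subfield (Lex (HahnSeries ℚ ℝ)) where
  carrier := {a | IsPuiseux (ofLex a)}
  mul_mem' {a b} ha hb := by
    obtain ⟨m, hm, x, y, hx, hy⟩ := exists_common_dilate ha hb
    have : ofLex (a * b) = dilate m hm (x * y) := by rw [map_mul (dilate m hm), hx, hy]; rfl
    change IsPuiseux (ofLex (a * b))
    rw [this]; exact isPuiseux_dilate _ _ _
  add_mem' {a b} ha hb := by
    obtain ⟨m, hm, x, y, hx, hy⟩ := exists_common_dilate ha hb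
    have : ofLex (a + b) = dilate m hm (x + y) := by rw [map_add (dilate m hm), hx, hy]; rfl
    change IsPuiseux (ofLex (a + b))
    rw [this]; exact isPuiseux_dilate _ _ _
  one_mem' := by
    have : ofLex (1 : Lex (HahnSeries ℚ ℝ)) = dilate 1 one_pos 1 := by
      rw [map_one (dilate 1 one_pos)]; rfl
    change IsPuiseux (ofLex 1)
    rw [this]; exact isPuiseux_dilate _ _ _
  zero_mem' := by
    have : ofLex (0 : Lex (HahnSeries ℚ ℝ)) = dilate 1 one_pos 0 := by
      rw [map_zero (dilate 1 one_pos)]; rfl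
    change IsPuiseux (ofLex 0)
    rw [this]; exact isPuiseux_dilate _ _ _
  neg_mem' {a} ha := by
    obtain ⟨m, hm, x, y, hx, hy⟩ := exists_common_dilate ha ha
    have : ofLex (-a) = dilate m hm (-x) := by rw [map_neg (dilate m hm), hx]; rfl
    change IsPuiseux (ofLex (-a))
    rw [this]; exact isPuiseux_dilate _ _ _
  inv_mem' a ha := by
    obtain ⟨m, hm, x, y, hx, hy⟩ := exists_common_dilate ha ha
    have : ofLex (a⁻¹) = dilate m hm (x⁻¹) := by rw [map_inv₀ (dilate m hm), hx]; rfl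
    change IsPuiseux (ofLex (a⁻¹))
    rw [this]; exact isPuiseux_dilate _ _ _

/-- The ordered field `𝔽` of real Puiseux series. -/
abbrev PuiseuxField : Type := puiseuxSubfield

/-- The power `X^q`, for a rational exponent `q`. -/
def Xpow (q : ℚ) : PuiseuxField :=
  ⟨toLex (HahnSeries.single (-q) 1), by
    refine ⟨q.den, q.den_pos, fun r hr => ⟨-q.num, ?_⟩⟩
    have : r = -q := by
      by_contra h
      exact hr (HahnSeries.coeff_single_of_ne h)
    rw [this]; push_cast; rw [neg_div, Rat.num_div_den]⟩

theorem Xpow_pos (q : ℚ) : 0 < Xpow q := by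
  change (0 : Lex (HahnSeries ℚ ℝ)) < toLex (HahnSeries.single (-q) 1)
  rw [← HahnSeries.leadingCoeff_pos_iff]
  simp

/-- The logarithm: the highest exponent of `X` occurring in a nonzero series.
(Only used on positive elements; the value at `0` is a placeholder.) -/
def log (a : PuiseuxField) : ℚ := -(ofLex a.1).order

theorem log_Xpow (q : ℚ) : log (Xpow q) = q := by
  change -(HahnSeries.single (-q) (1 : ℝ)).order = q
  rw [HahnSeries.order_single one_ne_zero, neg_neg]

theorem log_mul {a b : PuiseuxField} (ha : a ≠ 0) (hb : b ≠ 0) :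
    log (a * b) = log a + log b := by
  have ha' : ofLex a.1 ≠ 0 := fun h => ha (Subtype.ext h)
  have hb' : ofLex b.1 ≠ 0 := fun h => hb (Subtype.ext h)
  change -(ofLex a.1 * ofLex b.1).order = _
  rw [HahnSeries.order_mul ha' hb', neg_add]; rfl

theorem log_two : log 2 = 0 := by
  have h : ofLex ((2 : PuiseuxField) : Lex (HahnSeries ℚ ℝ)) = HahnSeries.C (2 : ℝ) := by
    rw [map_ofNat]; rfl
  change -(ofLex ((2 : PuiseuxField) : Lex (HahnSeries ℚ ℝ))).order = 0
  rw [h, HahnSeries.order_C, neg_zero]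

theorem log_le_log {a b : PuiseuxField} (ha : 0 < a) (hab : a ≤ b) : log a ≤ log b := by
  by_contra! h
  have hb : 0 < b := lt_of_lt_of_le ha hab
  have ha' : ofLex a.1 ≠ 0 := fun h => ha.ne' (Subtype.ext h)
  have h1 : (ofLex a.1).order < (ofLex b.1).order := by
    unfold log at h; linarith
  have h2 : (b : Lex (HahnSeries ℚ ℝ)) < a := by
    rw [HahnSeries.lt_iff]
    refine ⟨(ofLex a.1).order, fun j hj => ?_, ?_⟩
    · rw [HahnSeries.coeff_eq_zero_of_lt_order hj,
        HahnSeries.coeff_eq_zero_of_lt_order (hj.trans h1)]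
    · rw [HahnSeries.coeff_eq_zero_of_lt_order h1, ← HahnSeries.leadingCoeff_eq]
      exact HahnSeries.leadingCoeff_pos_iff.2 ha
  exact absurd hab (not_le.2 h2)

/-- Positive elements of `𝔽` are squares. -/
theorem exists_sqrt {a : PuiseuxField} (ha : 0 < a) : ∃ r : PuiseuxField, 0 < r ∧ r * r = a := by
  suffices h : ∃ r : PuiseuxField, r * r = a by
    obtain ⟨r, hr⟩ := h
    have h0 : r ≠ 0 := by rintro rfl; simp at hr; exact ha.ne hr
    exact ⟨|r|, abs_pos.2 h0, by rw [abs_mul_abs_self, hr]⟩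
  obtain ⟨m, hm, y, -, hy, -⟩ := exists_common_dilate a.2 a.2
  have hm' : (m : ℚ) ≠ 0 := by positivity
  have ha0 : ofLex a.1 ≠ 0 := fun h => ha.ne' (Subtype.ext h)
  have hy0 : y ≠ 0 := by rintro rfl; exact ha0 (by rw [← hy, map_zero])
  set n : ℤ := y.order with hn
  set c : ℝ := y.leadingCoeff with hc
  have hc0 : c ≠ 0 := HahnSeries.leadingCoeff_ne_zero.2 hy0
  have hcpos : 0 < c := by
    have h1 : 0 < (ofLex a.1).leadingCoeff := HahnSeries.leadingCoeff_pos_iff.2 ha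
    have h2 : (ofLex a.1).order = (n : ℚ) / m := by
      have h3 := HahnSeries.order_eq_orderTop_of_ne_zero ha0
      rw [← hy] at h3
      have h4 : (dilate m hm y).orderTop = WithTop.map (fun k : ℤ => (k : ℚ) / m) y.orderTop :=
        HahnSeries.orderTop_embDomain
      rw [h4, ← HahnSeries.order_eq_orderTop_of_ne_zero hy0, WithTop.map_coe] at h3
      rw [← hy]
      exact_mod_cast h3
    rw [HahnSeries.leadingCoeff_eq, h2, ← hy, dilate_coeff] at h1
    rwa [hc, HahnSeries.leadingCoeff_eq]
  -- `y = c T^n u` with `u` close to `1`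
  set u : HahnSeries ℤ ℝ := HahnSeries.single (-n) c⁻¹ * y with hu
  have hyu : y = HahnSeries.single n c * u := by
    rw [hu, ← mul_assoc, HahnSeries.single_mul_single]
    simp [mul_inv_cancel₀ hc0]
  have hu1 : 0 < (u - 1).orderTop := by
    rw [HahnSeries.orderTop_self_sub_one_pos_iff]
    have hne : (HahnSeries.single (-n) c⁻¹).leadingCoeff * y.leadingCoeff ≠ 0 := by
      rw [HahnSeries.leadingCoeff_of_single]; exact mul_ne_zero (inv_ne_zero hc0) hc0
    constructor
    · rw [hu, HahnSeries.orderTop_mul_of_ne_zero hne,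
        HahnSeries.orderTop_single (inv_ne_zero hc0),
        ← HahnSeries.order_eq_orderTop_of_ne_zero hy0, ← hn, ← WithTop.coe_add]
      simp
    · rw [hu, HahnSeries.leadingCoeff_mul_of_ne_zero hne, HahnSeries.leadingCoeff_of_single,
        ← hc, inv_mul_cancel₀ hc0]
  let v : HahnSeries ℤ ℝ := PowerSeries.heval (u - 1) (PowerSeries.binomialSeries ℝ (1 / 2 : ℝ))
  have hv : v * v = u := by
    change PowerSeries.heval (u - 1) (PowerSeries.binomialSeries ℝ (1 / 2 : ℝ)) *
      PowerSeries.heval (u - 1) (PowerSeries.binomialSeries ℝ (1 / 2 : ℝ)) = u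
    rw [← map_mul, ← PowerSeries.binomialSeries_add]
    have h1 : (1 / 2 + 1 / 2 : ℝ) = ((1 : ℕ) : ℝ) := by norm_num
    rw [h1, PowerSeries.binomialSeries_nat, pow_one, map_add, map_one, PowerSeries.heval_X _ hu1]
    ring
  let w : HahnSeries ℚ ℝ := dilate (2 * m) (by positivity) (HahnSeries.single n (Real.sqrt c))
  have hw : w * w = dilate m hm (HahnSeries.single n c) := by
    change dilate (2 * m) (by positivity) (HahnSeries.single n (Real.sqrt c)) *
      dilate (2 * m) (by positivity) (HahnSeries.single n (Real.sqrt c)) = _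
    rw [← map_mul, HahnSeries.single_mul_single, Real.mul_self_sqrt hcpos.le]
    rw [dilate_single, dilate_single]
    congr 1
    push_cast
    rw [← two_mul, mul_div_mul_left _ _ (two_ne_zero)]
  have hwm : (toLex w : Lex (HahnSeries ℚ ℝ)) ∈ puiseuxSubfield :=
    isPuiseux_dilate (2 * m) (by positivity) _
  have hvm : (toLex (dilate m hm v) : Lex (HahnSeries ℚ ℝ)) ∈ puiseuxSubfield :=
    isPuiseux_dilate m hm v
  refine ⟨⟨toLex w, hwm⟩ * ⟨toLex (dilate m hm v), hvm⟩, Subtype.ext ?_⟩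
  change (w * dilate m hm v) * (w * dilate m hm v) = ofLex a.1
  rw [mul_mul_mul_comm, hw, ← map_mul, hv, ← map_mul, ← hyu, hy]

/-- The field `𝔽[i]`, with `i² = -1`; its elements are written `⟨x, y⟩ = x + iy`. -/
abbrev PuiseuxComplex : Type := QuadraticAlgebra PuiseuxField (-1) 0

/-- The non-Archimedean hyperbolic plane `{x + iy | y > 0} ⊆ 𝔽[i]`. -/
def HypPlane : Type := {z : PuiseuxComplex // 0 < z.im}

namespace HypPlane

/-- The real part of a point of the plane. -/
def re (z : HypPlane) : PuiseuxField := z.1.re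

/-- The imaginary part of a point of the plane. -/
def im (z : HypPlane) : PuiseuxField := z.1.im

theorem im_pos (z : HypPlane) : 0 < z.im := z.2

/-- The point `x + iy`. -/
def mk (x y : PuiseuxField) (hy : 0 < y) : HypPlane := ⟨⟨x, y⟩, hy⟩

/-- The point `z` lies on the half-circle in the upper half-plane that meets `{y = 0}` at a right
angle in the points `w` and `w'`. -/
def OnHalfCircle (w w' : PuiseuxField) (z : HypPlane) : Prop :=
  (z.re - (w + w') / 2) ^ 2 + z.im ^ 2 = ((w' - w) / 2) ^ 2

/-- `c` is the cross-ratio `CR(w, z, z', w') = ((z' - w) (z - w')) / ((z - w) (z' - w'))`, where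
`w` and `w'` are the endpoints of an `𝔽`-line through `z` and `z'`, named such that `w, z, z', w'`
appear in this order on the line. The line is either vertical, with one endpoint at infinity,
in which case the two factors with that endpoint are left out, or it is a half-circle
with endpoints in `𝔽`. -/
inductive IsCrossRatio (z z' : HypPlane) (c : PuiseuxField) : Prop
  /-- the vertical ray above `w`, with `w' = ∞` -/
  | up (w : PuiseuxField) (hz : z.re = w) (hz' : z'.re = w) (order : z.im ≤ z'.im)
      (eq : c • (z.1 - .C w) = z'.1 - .C w)
  /-- the vertical ray above `w'`, with `w = ∞` -/
  | down (w' : PuiseuxField) (hz : z.re = w') (hz' : z'.re = w') (order : z'.im ≤ z.im)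
      (eq : c • (z'.1 - .C w') = z.1 - .C w')
  /-- the half-circle from `w` to `w'`, on which points are ordered by their real parts -/
  | circle (w w' : PuiseuxField) (hz : OnHalfCircle w w' z) (hz' : OnHalfCircle w w' z')
      (order : (w < w' ∧ z.re < z'.re) ∨ (w' < w ∧ z'.re < z.re))
      (eq : c • ((z.1 - .C w) * (z'.1 - .C w')) = (z'.1 - .C w) * (z.1 - .C w'))

/-- The algebra behind the half-circle case, in terms of the distances `A = x - w`, `B = w' - x`,
`A' = x' - w` and `B' = w' - x'`. -/
theorem circle_aux {K : Type*} [Field K] [LinearOrder K] [IsStrictOrderedRing K]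
    {A B A' B' y y' c : K} (hy : 0 < y) (hy' : 0 < y') (hAB : A + B = A' + B')
    (h : y ^ 2 = A * B) (h' : y' ^ 2 = A' * B')
    (ho : (0 < A + B ∧ A < A') ∨ (A + B < 0 ∧ A' < A))
    (hc : c * (A * B' + y * y') = A' * B + y * y') :
    1 ≤ c ∧ c + c⁻¹ = ((A - A') ^ 2 + y ^ 2 + y' ^ 2) / (y * y') := by
  have hs : 0 < y * y' := mul_pos hy hy'
  have hpos : 0 < A * B' := by
    have hABpos : 0 < A * B := by rw [← h]; positivity
    have hAB'pos : 0 < A' * B' := by rw [← h']; positivity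
    rcases ho with ⟨h0, -⟩ | ⟨h0, -⟩
    · have hA : 0 < A := by
        rcases pos_and_pos_or_neg_and_neg_of_mul_pos hABpos with ⟨h1, h2⟩ | ⟨h1, h2⟩ <;> linarith
      have hB' : 0 < B' := by
        rcases pos_and_pos_or_neg_and_neg_of_mul_pos hAB'pos with ⟨h1, h2⟩ | ⟨h1, h2⟩ <;> linarith
      exact mul_pos hA hB'
    · have hA : A < 0 := by
        rcases pos_and_pos_or_neg_and_neg_of_mul_pos hABpos with ⟨h1, h2⟩ | ⟨h1, h2⟩ <;> linarith
      have hB' : B' < 0 := by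
        rcases pos_and_pos_or_neg_and_neg_of_mul_pos hAB'pos with ⟨h1, h2⟩ | ⟨h1, h2⟩ <;> linarith
      exact mul_pos_of_neg_of_neg hA hB'
  have hle : A * B' ≤ A' * B := by
    have : A' * B - A * B' = (A' - A) * (A + B) := by
      have : B' = A + B - A' := by linarith
      rw [this]; ring
    have h2 : 0 ≤ (A' - A) * (A + B) := by
      rcases ho with ⟨h0, h1⟩ | ⟨h0, h1⟩
      · exact mul_nonneg (by linarith) h0.le
      · exact mul_nonneg_of_nonpos_of_nonpos (by linarith) h0.le
    linarith
  have hd : 0 < A * B' + y * y' := by positivity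
  have hc1 : 1 ≤ c := by
    by_contra! hlt
    have := mul_lt_mul_of_pos_right hlt hd
    linarith
  refine ⟨hc1, ?_⟩
  have hprod : (A' * B) * (A * B') = (y * y') ^ 2 := by
    rw [mul_pow, h, h']; ring
  have hcs : c * (A * B') = y * y' := by
    have h1 : (c * (A * B') - y * y') * (A * B' + y * y') = 0 := by
      linear_combination (A * B') * hc + hprod
    rcases mul_eq_zero.1 h1 with h2 | h2
    · linarith
    · exact absurd h2 hd.ne'
  have hc0 : c ≠ 0 := by positivity
  have hsum : (A - A') ^ 2 + y ^ 2 + y' ^ 2 = A' * B + A * B' := by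
    have : B' = A + B - A' := by linarith
    rw [h, h', this]; ring
  have hcs' : A' * B = c * (y * y') := by linear_combination -hc + hcs
  rw [hsum, hcs', ← hcs]
  have hne : A * B' ≠ 0 := hpos.ne'
  rw [eq_div_iff (mul_ne_zero hc0 hne)]
  linear_combination (A * B') * inv_mul_cancel₀ hc0

/-- A cross-ratio as above is at least `1` and is determined by the coordinates of the points. -/
theorem IsCrossRatio.spec {z z' : HypPlane} {c : PuiseuxField} (h : IsCrossRatio z z' c) :
    1 ≤ c ∧ c + c⁻¹ = ((z.re - z'.re) ^ 2 + z.im ^ 2 + z'.im ^ 2) / (z.im * z'.im) := by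
  have hy := z.im_pos
  have hy' := z'.im_pos
  rcases h with ⟨w, hz, hz', order, eq⟩ | ⟨w, hz, hz', order, eq⟩ | ⟨w, w', hz, hz', order, eq⟩
  · have e : c * z.im = z'.im := by
      have e := congrArg QuadraticAlgebra.im eq
      simp only [QuadraticAlgebra.im_smul, QuadraticAlgebra.im_sub, QuadraticAlgebra.im_C,
        sub_zero, smul_eq_mul] at e
      exact e
    have hc : 1 ≤ c := by
      by_contra! hlt
      have := mul_lt_mul_of_pos_right hlt hy
      linarith
    have hc0 : c ≠ 0 := by positivity
    refine ⟨hc, ?_⟩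
    rw [hz, hz', ← e]
    have := hy.ne'
    field_simp
    ring
  · have e : c * z'.im = z.im := by
      have e := congrArg QuadraticAlgebra.im eq
      simp only [QuadraticAlgebra.im_smul, QuadraticAlgebra.im_sub, QuadraticAlgebra.im_C,
        sub_zero, smul_eq_mul] at e
      exact e
    have hc : 1 ≤ c := by
      by_contra! hlt
      have := mul_lt_mul_of_pos_right hlt hy'
      linarith
    have hc0 : c ≠ 0 := by positivity
    refine ⟨hc, ?_⟩
    rw [hz, hz', ← e]
    have := hy'.ne'
    field_simp
    ring
  · have e := congrArg QuadraticAlgebra.re eq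
    simp only [QuadraticAlgebra.re_smul, QuadraticAlgebra.re_mul, QuadraticAlgebra.re_sub,
      QuadraticAlgebra.im_sub, QuadraticAlgebra.re_C, QuadraticAlgebra.im_C, smul_eq_mul] at e
    change c * ((z.re - w) * (z'.re - w') + -1 * (z.im - 0) * (z'.im - 0)) =
      (z'.re - w) * (z.re - w') + -1 * (z'.im - 0) * (z.im - 0) at e
    unfold OnHalfCircle at hz hz'
    have := circle_aux (A := z.re - w) (B := w' - z.re) (A' := z'.re - w) (B' := w' - z'.re)
      (c := c) hy hy' (by ring) (by linear_combination hz) (by linear_combination hz')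
      (by rcases order with ⟨h1, h2⟩ | ⟨h1, h2⟩
          · exact Or.inl ⟨by linarith, by linarith⟩
          · exact Or.inr ⟨by linarith, by linarith⟩)
      (by linear_combination -e)
    refine ⟨this.1, this.2.trans ?_⟩
    congr 1
    ring

/-- Any two points have a cross-ratio. -/
theorem exists_isCrossRatio (z z' : HypPlane) : ∃ c, IsCrossRatio z z' c := by
  have hy := z.im_pos
  have hy' := z'.im_pos
  have hy0 := hy.ne'
  have hy0' := hy'.ne'
  by_cases hre : z.re = z'.re
  · rcases le_total z.im z'.im with h | h
    · refine ⟨z'.im / z.im, .up z.re rfl hre.symm h (QuadraticAlgebra.ext ?_ ?_)⟩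
      · change z'.im / z.im * (z.re - z.re) = z'.re - z.re
        rw [hre]; ring
      · change z'.im / z.im * (z.im - 0) = z'.im - 0
        rw [sub_zero, sub_zero]
        field_simp
    · refine ⟨z.im / z'.im, .down z.re rfl hre.symm h (QuadraticAlgebra.ext ?_ ?_)⟩
      · change z.im / z'.im * (z'.re - z.re) = z.re - z.re
        rw [hre]; ring
      · change z.im / z'.im * (z'.im - 0) = z.im - 0
        rw [sub_zero, sub_zero]
        field_simp
  · have hd : z'.re - z.re ≠ 0 := sub_ne_zero.2 (Ne.symm hre)
    obtain ⟨k, hk⟩ : ∃ k, (z.re - k) ^ 2 + z.im ^ 2 = (z'.re - k) ^ 2 + z'.im ^ 2 := by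
      refine ⟨(z'.re ^ 2 + z'.im ^ 2 - z.re ^ 2 - z.im ^ 2) / (2 * (z'.re - z.re)), ?_⟩
      field_simp
      ring
    obtain ⟨r, hr, hrr⟩ := exists_sqrt (a := (z.re - k) ^ 2 + z.im ^ 2) (by positivity)
    obtain ⟨ρ, hρ, ho⟩ : ∃ ρ : PuiseuxField, ρ * ρ = r * r ∧
        ((k - ρ < k + ρ ∧ z.re < z'.re) ∨ (k + ρ < k - ρ ∧ z'.re < z.re)) := by
      rcases lt_or_gt_of_ne hre with h | h
      · exact ⟨r, rfl, Or.inl ⟨by linarith, h⟩⟩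
      · exact ⟨-r, by ring, Or.inr ⟨by linarith, h⟩⟩
    have e : (z.re - k) ^ 2 + z.im ^ 2 = ρ * ρ := by rw [hρ, hrr]
    have e' : (z'.re - k) ^ 2 + z'.im ^ 2 = ρ * ρ := by rw [← hk, e]
    obtain ⟨c, hc⟩ : ∃ c, c * (z.im * z'.im) = (z'.re - (k - ρ)) * ((k + ρ) - z.re) :=
      ⟨(z'.re - (k - ρ)) * ((k + ρ) - z.re) / (z.im * z'.im), by field_simp⟩
    have h1 : c * (z.re - (k - ρ)) * z'.im = (z'.re - (k - ρ)) * z.im := by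
      apply mul_right_cancel₀ hy0
      linear_combination (z.re - (k - ρ)) * hc - (z'.re - (k - ρ)) * e
    have h2 : c * z.im * ((k + ρ) - z'.re) = z'.im * ((k + ρ) - z.re) := by
      apply mul_right_cancel₀ hy0'
      linear_combination ((k + ρ) - z'.re) * hc - ((k + ρ) - z.re) * e'
    have h3 : c * ((z.re - (k - ρ)) * ((k + ρ) - z'.re)) = z.im * z'.im := by
      apply mul_right_cancel₀ hy0'
      linear_combination ((k + ρ) - z'.re) * h1 - z.im * e'
    refine ⟨c, .circle (k - ρ) (k + ρ) ?_ ?_ ho (QuadraticAlgebra.ext ?_ ?_)⟩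
    · unfold OnHalfCircle
      linear_combination e
    · unfold OnHalfCircle
      linear_combination e'
    · change c * ((z.re - (k - ρ)) * (z'.re - (k + ρ)) + -1 * (z.im - 0) * (z'.im - 0)) =
        (z'.re - (k - ρ)) * (z.re - (k + ρ)) + -1 * (z'.im - 0) * (z.im - 0)
      linear_combination -h3 - hc
    · change c * ((z.re - (k - ρ)) * (z'.im - 0) + (z.im - 0) * (z'.re - (k + ρ)) +
            0 * (z.im - 0) * (z'.im - 0)) =
        (z'.re - (k - ρ)) * (z.im - 0) + (z'.im - 0) * (z.re - (k + ρ)) +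
          0 * (z'.im - 0) * (z.im - 0)
      linear_combination h1 - h2

/-- The cross-ratio `CR(w, z, z', w')` of the quadruple determined by two points. -/
def crossRatio (z z' : HypPlane) : PuiseuxField := (exists_isCrossRatio z z').choose

theorem isCrossRatio_crossRatio (z z' : HypPlane) : IsCrossRatio z z' (crossRatio z z') :=
  (exists_isCrossRatio z z').choose_spec

/-- The `ℚ`-valued pseudo-distance: the logarithm of the cross-ratio. -/
def pseudoDist (z z' : HypPlane) : ℚ := log (crossRatio z z')

theorem pseudoDist_eq (z z' : HypPlane) :
    pseudoDist z z' = log (((z.re - z'.re) ^ 2 + z.im ^ 2 + z'.im ^ 2) / (z.im * z'.im)) := by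
  obtain ⟨h1, h2⟩ := (isCrossRatio_crossRatio z z').spec
  rw [pseudoDist, ← h2]
  set c := crossRatio z z'
  have hc : 0 < c := lt_of_lt_of_le one_pos h1
  have hinv : 0 < c⁻¹ := inv_pos.2 hc
  have hinv1 : c⁻¹ ≤ 1 := inv_le_one_of_one_le₀ h1
  apply le_antisymm
  · exact log_le_log hc (by linarith)
  · have h3 : log (c + c⁻¹) ≤ log (2 * c) := log_le_log (by positivity) (by linarith)
    rwa [log_mul two_ne_zero hc.ne', log_two, zero_add] at h3

theorem pseudoDist_self (z : HypPlane) : pseudoDist z z = 0 := by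
  have hy := z.im_pos.ne'
  rw [pseudoDist_eq]
  have : ((z.re - z.re) ^ 2 + z.im ^ 2 + z.im ^ 2) / (z.im * z.im) = 2 := by
    field_simp
    ring
  rw [this, log_two]

theorem pseudoDist_comm (z z' : HypPlane) : pseudoDist z z' = pseudoDist z' z := by
  have e : ((z.re - z'.re) ^ 2 + z.im ^ 2 + z'.im ^ 2) / (z.im * z'.im) =
      ((z'.re - z.re) ^ 2 + z'.im ^ 2 + z.im ^ 2) / (z'.im * z.im) := by
    rw [mul_comm z'.im z.im]
    congr 1
    ring
  rw [pseudoDist_eq, pseudoDist_eq, e]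

/-- The algebra behind the triangle inequality. -/
theorem triangle_aux {K : Type*} [Field K] [LinearOrder K] [IsStrictOrderedRing K]
    {x x' x'' y y' y'' : K} (hy : 0 < y) (hy' : 0 < y') (hy'' : 0 < y'') :
    ((x - x'') ^ 2 + y ^ 2 + y'' ^ 2) / (y * y'') ≤
      2 * (2 * (((x - x') ^ 2 + y ^ 2 + y' ^ 2) / (y * y') *
        (((x' - x'') ^ 2 + y' ^ 2 + y'' ^ 2) / (y' * y'')))) := by
  have h1 : (x - x'') ^ 2 + y ^ 2 + y'' ^ 2 ≤
      2 * ((x - x') ^ 2 + y ^ 2 + y' ^ 2) + 2 * ((x' - x'') ^ 2 + y' ^ 2 + y'' ^ 2) := by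
    nlinarith [sq_nonneg ((x - x') - (x' - x'')), sq_nonneg y, sq_nonneg y', sq_nonneg y'']
  have h2 : y' ^ 2 ≤ (x - x') ^ 2 + y ^ 2 + y' ^ 2 := by
    nlinarith [sq_nonneg (x - x'), sq_nonneg y]
  have h3 : y' ^ 2 ≤ (x' - x'') ^ 2 + y' ^ 2 + y'' ^ 2 := by
    nlinarith [sq_nonneg (x' - x''), sq_nonneg y'']
  have hS : 0 ≤ (x - x') ^ 2 + y ^ 2 + y' ^ 2 := by positivity
  have hS' : 0 ≤ (x' - x'') ^ 2 + y' ^ 2 + y'' ^ 2 := by positivity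
  generalize (x - x') ^ 2 + y ^ 2 + y' ^ 2 = S at *
  generalize (x' - x'') ^ 2 + y' ^ 2 + y'' ^ 2 = S' at *
  generalize (x - x'') ^ 2 + y ^ 2 + y'' ^ 2 = R at *
  have h4 : R * y' ^ 2 ≤ 2 * (2 * (S * S')) := by
    have a1 := mul_le_mul_of_nonneg_right h1 (sq_nonneg y')
    have a2 := mul_le_mul_of_nonneg_left h3 hS
    have a3 := mul_le_mul_of_nonneg_left h2 hS'
    linarith
  have e : 2 * (2 * (S / (y * y') * (S' / (y' * y'')))) =
      (2 * (2 * (S * S'))) / (y' ^ 2 * (y * y'')) := by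
    field_simp
  have e' : R / (y * y'') = R * y' ^ 2 / (y' ^ 2 * (y * y'')) := by
    field_simp
  rw [e, e']
  gcongr

theorem pseudoDist_triangle (z z' z'' : HypPlane) :
    pseudoDist z z'' ≤ pseudoDist z z' + pseudoDist z' z'' := by
  have hy := z.im_pos
  have hy' := z'.im_pos
  have hy'' := z''.im_pos
  rw [pseudoDist_eq, pseudoDist_eq, pseudoDist_eq]
  have hpos : 0 < ((z.re - z'.re) ^ 2 + z.im ^ 2 + z'.im ^ 2) / (z.im * z'.im) := by positivity
  have hpos' : 0 < ((z'.re - z''.re) ^ 2 + z'.im ^ 2 + z''.im ^ 2) / (z'.im * z''.im) := by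
    positivity
  have h6 := log_le_log (by positivity)
    (triangle_aux (K := PuiseuxField) (x := z.re) (x' := z'.re) (x'' := z''.re) hy hy' hy'')
  have hpp := mul_pos hpos hpos'
  rwa [log_mul two_ne_zero (mul_pos two_pos hpp).ne', log_mul two_ne_zero hpp.ne', log_two,
    zero_add, zero_add, log_mul hpos.ne' hpos'.ne'] at h6

theorem pseudoDist_nonneg (z z' : HypPlane) : 0 ≤ pseudoDist z z' := by
  have h := pseudoDist_triangle z z' z
  rw [pseudoDist_self, pseudoDist_comm z' z] at h
  linarith

end HypPlane

/-- The relation that identifies two points at pseudo-distance zero. -/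
def zeroDistSetoid : Setoid HypPlane where
  r z z' := z.pseudoDist z' = 0
  iseqv :=
    { refl := HypPlane.pseudoDist_self
      symm := fun {z z'} h => by rw [HypPlane.pseudoDist_comm]; exact h
      trans := fun {z z' z''} h h' => by
        have h1 := HypPlane.pseudoDist_triangle z z' z''
        have h2 := HypPlane.pseudoDist_nonneg z z''
        linarith }

/-- Brumfiel's `ℚ`-tree `𝒯_𝔽`, the quotient of the hyperbolic plane over `𝔽` by `{d = 0}`. -/
def BrumfielTree : Type := Quotient zeroDistSetoid

/-- The projection `π` from the hyperbolic plane to the tree. -/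
def proj (z : HypPlane) : BrumfielTree := Quotient.mk zeroDistSetoid z

/-- The `ℚ`-valued distance on the tree induced by the pseudo-distance. -/
def treeDist : BrumfielTree → BrumfielTree → ℚ :=
  Quotient.lift₂ HypPlane.pseudoDist (by
    intro a b a' b' (ha : a.pseudoDist a' = 0) (hb : b.pseudoDist b' = 0)
    have h1 := HypPlane.pseudoDist_triangle a a' b
    have h2 := HypPlane.pseudoDist_triangle a' b' b
    have h3 := HypPlane.pseudoDist_triangle a' a b'
    have h4 := HypPlane.pseudoDist_triangle a b b'
    rw [HypPlane.pseudoDist_comm b' b] at h2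
    rw [HypPlane.pseudoDist_comm a' a] at h3
    linarith)

theorem treeDist_proj (z z' : HypPlane) : treeDist (proj z) (proj z') = z.pseudoDist z' := rfl

/-- The tree as a metric space, with the `ℚ`-valued distance viewed in `ℝ`. -/
instance : MetricSpace BrumfielTree where
  dist p q := (treeDist p q : ℝ)
  dist_self p := by
    induction p using Quotient.inductionOn with
    | h z => exact_mod_cast HypPlane.pseudoDist_self z
  dist_comm p q := by
    induction p, q using Quotient.inductionOn₂ with
    | h z z' => exact_mod_cast HypPlane.pseudoDist_comm z z'
  dist_triangle p q r := by
    induction p, q, r using Quotient.inductionOn₃ with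
    | h z z' z'' => exact_mod_cast HypPlane.pseudoDist_triangle z z' z''
  eq_of_dist_eq_zero {p q} h := by
    induction p, q using Quotient.inductionOn₂ with
    | h z z' => exact Quotient.sound (s := zeroDistSetoid) (by exact_mod_cast h)

section SegmentCompletion

open UniformSpace (Completion)

/-- A `ℚ`-segment of a metric space: the image of an isometric embedding of a rational interval
`[a, b] ⊆ ℚ`, `a ≤ b`. -/
def IsRatSegment {T : Type*} [MetricSpace T] (s : Set T) : Prop :=
  ∃ a b : ℚ, a ≤ b ∧ ∃ φ : Set.Icc a b → T, Isometry φ ∧ s = Set.range φ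

/-- The metric completion of a subset `s ⊆ T`, realised in the metric completion of the ambient
space `T` as the image of the isometric embedding `Completion s → Completion T` that extends the
inclusion `s → T`. -/
def completedSubset {T : Type*} [MetricSpace T] (s : Set T) : Set (Completion T) :=
  Set.range (Completion.map (Subtype.val : s → T))

/-- The completed subset is the closure of the subset in the completion of the ambient space. -/
theorem completedSubset_eq_closure {T : Type*} [MetricSpace T] (s : Set T) :
    completedSubset s = closure ((fun x : T => (x : Completion T)) '' s) := by
  have hiso : Isometry (Completion.map (Subtype.val : s → T)) :=
    (isometry_subtype_coe (s := s)).completion_map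
  have hcl : IsClosed (completedSubset s) := hiso.isClosedEmbedding.isClosed_range
  apply Set.Subset.antisymm
  · have hd : closure (Set.range (fun x : s => (x : Completion s))) = Set.univ :=
      Completion.denseRange_coe.closure_range
    rw [completedSubset, ← Set.image_univ, ← hd]
    refine (image_closure_subset_closure_image hiso.continuous).trans (closure_mono ?_)
    rintro _ ⟨_, ⟨x, rfl⟩, rfl⟩
    refine ⟨x, x.2, ?_⟩
    rw [Completion.map_coe isometry_subtype_coe.uniformContinuous]
  · refine closure_minimal ?_ hcl
    rintro _ ⟨x, hx, rfl⟩
    exact ⟨((⟨x, hx⟩ : s) : Completion s),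
      Completion.map_coe isometry_subtype_coe.uniformContinuous _⟩

/-- The underlying set of the segment completion of `T`: the union, over all `ℚ`-segments `s` of
`T`, of the metric completions of `s`. -/
def segmentCompletionSet (T : Type*) [MetricSpace T] : Set (Completion T) :=
  ⋃ s ∈ {s : Set T | IsRatSegment s}, completedSubset s

/-- The segment completion `T^sc`, with the metric inherited from the completion of `T`. -/
abbrev SegmentCompletion (T : Type*) [MetricSpace T] : Type _ := segmentCompletionSet T

/-- The isometric embedding `T → T^sc`; a point of `T` lies in its own one-point segment. -/
def toSegmentCompletion {T : Type*} [MetricSpace T] (x : T) : SegmentCompletion T :=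
  ⟨(x : Completion T), by
    refine Set.mem_biUnion (x := {x})
      ⟨0, 0, le_rfl, fun _ => x, ?_, ?_⟩ ?_
    · intro u v
      have : u = v := Subtype.ext (by
        have hu := u.2
        have hv := v.2
        simp only [Set.Icc_self, Set.mem_singleton_iff] at hu hv
        rw [hu, hv])
      rw [this, edist_self, edist_self]
    · ext y
      simp [eq_comm]
    · rw [completedSubset_eq_closure]
      exact subset_closure ⟨x, rfl, rfl⟩⟩

end SegmentCompletion

/-- The exponents `t_n = -1 + 2^(-n)`. -/
def t (n : ℕ) : ℚ := -1 + 1 / 2 ^ n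

/-- The points `p_n = a_n + i b_n`, where `a_n = X^(t_1) + ⋯ + X^(t_n)` and `b_n = X^(t_n)`. -/
def p (n : ℕ) : HypPlane :=
  HypPlane.mk (∑ k ∈ Finset.Icc 1 n, Xpow (t k)) (Xpow (t n)) (Xpow_pos _)

end Puiseux

end

namespace Puiseux

/-! Logarithmically, the distance between `x + iy` and `x' + iy'` with `x ≠ x'` is `max(2 log (x -
x'), 2 log y, 2 log y') - log y - log y'`. A point of the tree can thus be pictured as a ball in `𝔽`
with centre `x` and logarithmic radius `log y`. The `p_n` are nested balls whose logarithmic radii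
`t_n` decrease to `-1` and whose centres are the partial sums of `∑ X^(t_k)`. That formal sum is not
a Puiseux series, because the denominators `2^k` of its exponents are unbounded, so no centre in `𝔽`
is common to all the balls.

Consequently, for a fixed point `z`, the leading exponent of `Re p_n - Re z` is eventually constant
and at least `t_n`, and the distance from `p_n` to `z` has the form `C - t_n` with `C` rational
(`exists_pseudoDist_p_eq`). A limit of the sequence would have distance `C + 1` from `π(z)`, which
is rational and positive (`exists_rat_dist_eq`).

On the other hand, a point in the completion of a rational segment is determined by its distance to
an end of the segment. If this distance is rational, the point already lies on the segment
(`IsRatSegment.exists_eq_of_mem_completedSubset`). So a limit in the segment completion would belong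
to the tree and have positive distance from itself. -/

/-! ### Logarithms and the explicit distance formula -/

/-- Leading terms of positive series cannot cancel: `a + b` lies between `max a b` and `2 * max a
b`, and `log 2 = 0`. -/
theorem log_add {a b : PuiseuxField} (ha : 0 < a) (hb : 0 < b) :
    log (a + b) = max (log a) (log b) := by
  apply le_antisymm
  · have hm : 0 < max a b := lt_max_of_lt_left ha
    have h : log (a + b) ≤ log (2 * max a b) := by
      apply log_le_log (add_pos ha hb)
      rw [two_mul]
      exact add_le_add (le_max_left a b) (le_max_right a b)
    rw [log_mul two_ne_zero hm.ne', log_two, zero_add] at h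
    refine h.trans ?_
    rcases max_cases a b with ⟨h, -⟩ | ⟨h, -⟩ <;> rw [h]
    · exact le_max_left _ _
    · exact le_max_right _ _
  · exact max_le (log_le_log ha (le_add_of_nonneg_right hb.le))
      (log_le_log hb (le_add_of_nonneg_left ha.le))

theorem log_div {a b : PuiseuxField} (ha : a ≠ 0) (hb : b ≠ 0) :
    log (a / b) = log a - log b := by
  have h := log_mul (div_ne_zero ha hb) hb
  rw [div_mul_cancel₀ a hb] at h
  linarith

theorem log_sq {a : PuiseuxField} (ha : a ≠ 0) : log (a ^ 2) = 2 * log a := by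
  rw [sq, log_mul ha ha, two_mul]

/-- The distance of two points with distinct real parts, in terms of the highest exponents. -/
theorem HypPlane.pseudoDist_eq_max {z z' : HypPlane} (h : z.re ≠ z'.re) :
    z.pseudoDist z' =
      max (max (2 * log (z.re - z'.re)) (2 * log z.im)) (2 * log z'.im) -
        (log z.im + log z'.im) := by
  have hy := z.im_pos
  have hy' := z'.im_pos
  have hx : 0 < (z.re - z'.re) ^ 2 := by
    have := sub_ne_zero.2 h
    positivity
  rw [HypPlane.pseudoDist_eq, log_div (by positivity) (by positivity), log_mul hy.ne' hy'.ne',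
    log_add (by positivity) (by positivity), log_add hx (by positivity),
    log_sq (sub_ne_zero.2 h), log_sq hy.ne', log_sq hy'.ne']

/-! ### The exponents `t_n` and coefficients of Puiseux series -/

theorem t_strictAnti : StrictAnti t := by
  apply strictAnti_nat_of_succ_lt
  intro n
  have h : (0 : ℚ) < 1 / 2 ^ n := by positivity
  have e : (1 : ℚ) / 2 ^ (n + 1) = 1 / 2 ^ n / 2 := by rw [pow_succ]; field_simp
  unfold t
  rw [e]
  linarith

theorem neg_one_lt_t (n : ℕ) : -1 < t n := by
  have h : (0 : ℚ) < 1 / 2 ^ n := by positivity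
  unfold t
  linarith

theorem tendsto_t : Filter.Tendsto (fun n => (t n : ℝ)) Filter.atTop (nhds (-1)) := by
  have h := (tendsto_pow_atTop_nhds_zero_of_lt_one (r := (1 / 2 : ℝ)) (by norm_num)
    (by norm_num)).const_add (-1)
  rw [add_zero] at h
  refine h.congr fun n => ?_
  unfold t
  push_cast
  rw [one_div_pow]

/-- The coefficient of `X^(-q)`. -/
def coeffHom (q : ℚ) : PuiseuxField →+ ℝ where
  toFun a := (ofLex a.1).coeff q
  map_zero' := rfl
  map_add' _ _ := rfl

theorem coeffHom_Xpow_self (q : ℚ) : coeffHom (-q) (Xpow q) = 1 :=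
  HahnSeries.coeff_single_same _ _

theorem coeffHom_Xpow_of_ne {q r : ℚ} (h : r ≠ -q) : coeffHom r (Xpow q) = 0 :=
  HahnSeries.coeff_single_of_ne h

theorem le_log_of_coeffHom_ne_zero {q : ℚ} {a : PuiseuxField} (h : coeffHom q a ≠ 0) :
    -q ≤ log a :=
  neg_le_neg (HahnSeries.order_le_of_coeff_ne_zero h)

theorem coeffHom_log_ne_zero {a : PuiseuxField} (ha : a ≠ 0) : coeffHom (-log a) a ≠ 0 := by
  have h : ofLex a.1 ≠ 0 := fun h => ha (Subtype.ext h)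
  change (ofLex a.1).coeff (- -(ofLex a.1).order) ≠ 0
  rw [neg_neg]
  exact HahnSeries.coeff_order_eq_zero.not.2 h

/-- The leading exponent of `a` also occurs in `b`, with the same nonzero coefficient. Used in both
directions, this shows that the leading exponent of `Re p_n - Re z` stabilises. -/
theorem log_le_log_of_coeffHom {a b : PuiseuxField} (ha : a ≠ 0)
    (h : coeffHom (-log a) a = coeffHom (-log a) b) : log a ≤ log b := by
  have := le_log_of_coeffHom_ne_zero (h ▸ coeffHom_log_ne_zero ha)
  rwa [neg_neg] at this

theorem re_p (n : ℕ) : (p n).re = ∑ k ∈ Finset.Icc 1 n, Xpow (t k) := rfl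

theorem im_p (n : ℕ) : (p n).im = Xpow (t n) := rfl

theorem coeffHom_re_p {k n : ℕ} (hk : 1 ≤ k) (hn : k ≤ n) : coeffHom (-t k) (p n).re = 1 := by
  rw [re_p, map_sum, Finset.sum_eq_single_of_mem k (Finset.mem_Icc.2 ⟨hk, hn⟩),
    coeffHom_Xpow_self]
  intro j _ hj
  exact coeffHom_Xpow_of_ne fun h => hj (t_strictAnti.injective (neg_injective h)).symm

/-- The terms added after index `k` have exponents strictly below `t k`, so they leave the
coefficients of all higher powers of `X`, and of `X^(t k)`, unchanged. -/
theorem coeffHom_re_p_eq {k n : ℕ} (hn : k ≤ n) {q : ℚ} (hq : q ≤ -t k) :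
    coeffHom q (p n).re = coeffHom q (p k).re := by
  rw [re_p, re_p, map_sum, map_sum]
  refine (Finset.sum_subset (Finset.Icc_subset_Icc_right hn) fun j hj hj' => ?_).symm
  rw [Finset.mem_Icc] at hj hj'
  have : t j < t k := t_strictAnti (by omega)
  exact coeffHom_Xpow_of_ne (by linarith)

/-- A Puiseux series has bounded denominators, so it cannot contain all the terms `X^(t_k)`. -/
theorem exists_coeffHom_ne_one (c : PuiseuxField) : ∃ k : ℕ, 1 ≤ k ∧ coeffHom (-t k) c ≠ 1 := by
  obtain ⟨m, hm, h⟩ := c.2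
  -- The common denominator `m` of `c` serves as the index: the denominator of `t m` is `2 ^ m`,
  -- which exceeds `m`.
  refine ⟨m, hm, fun h1 => ?_⟩
  have hs : coeffHom (-t m) c ≠ 0 := by rw [h1]; exact one_ne_zero
  obtain ⟨j, hj⟩ := h (-t m) hs
  have hmQ : (0 : ℚ) < m := by exact_mod_cast hm
  have h2 : (m : ℚ) < 2 ^ m := by exact_mod_cast Nat.lt_two_pow_self
  -- From `-t m = j / m`, the integer `m - j` equals `m / 2 ^ m`, which lies strictly between 0 and
  -- 1.
  have e : ((m - j : ℤ) : ℚ) = m / 2 ^ m := by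
    unfold t at hj
    field_simp at hj
    field_simp
    push_cast
    linarith
  have h3 : (0 : ℚ) < ((m - j : ℤ) : ℚ) := by rw [e]; positivity
  have h4 : ((m - j : ℤ) : ℚ) < 1 := by rw [e, div_lt_one (by positivity)]; exact h2
  have h5 : 0 < (m - j : ℤ) := by exact_mod_cast h3
  have h6 : (m - j : ℤ) < 1 := by exact_mod_cast h4
  omega

/-! ### Distances to and between the points `p_n` -/

/-- The distance to `p n` is eventually of the form `C - t n`, with `C` rational. -/
theorem exists_pseudoDist_p_eq (z : HypPlane) :
    ∃ (C : ℚ) (k : ℕ), ∀ n, k ≤ n → (p n).pseudoDist z = C - t n := by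
  obtain ⟨k, hk, hc⟩ := exists_coeffHom_ne_one z.re
  have hcoeff : ∀ n, k ≤ n → coeffHom (-t k) ((p n).re - z.re) ≠ 0 := fun n hn => by
    rw [map_sub, coeffHom_re_p hk hn]
    exact sub_ne_zero.2 hc.symm
  have hne : ∀ n, k ≤ n → (p n).re - z.re ≠ 0 := fun n hn h =>
    hcoeff n hn (by rw [h, map_zero])
  have hle : ∀ n, k ≤ n → t k ≤ log ((p n).re - z.re) := fun n hn => by
    simpa using le_log_of_coeffHom_ne_zero (hcoeff n hn)
  have heq : ∀ n, k ≤ n → ∀ q ≤ -t k,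
      coeffHom q ((p n).re - z.re) = coeffHom q ((p k).re - z.re) := fun n hn q hq => by
    rw [map_sub, map_sub, coeffHom_re_p_eq hn hq]
  have hlog : ∀ n, k ≤ n → log ((p n).re - z.re) = log ((p k).re - z.re) := fun n hn =>
    le_antisymm
      (log_le_log_of_coeffHom (hne n hn) (heq n hn _ (neg_le_neg (hle n hn))))
      (log_le_log_of_coeffHom (hne k le_rfl) (heq n hn _ (neg_le_neg (hle k le_rfl))).symm)
  -- Since `t n ≤ t k ≤ log ((p k).re - z.re)`, the term `2 * t n` drops out of the maximum, and `n`
  -- enters only through the subtracted `log (p n).im = t n`.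
  refine ⟨max (2 * log ((p k).re - z.re)) (2 * log z.im) - log z.im, k, fun n hn => ?_⟩
  have ht : t n ≤ log ((p k).re - z.re) := (t_strictAnti.antitone hn).trans (hle k le_rfl)
  rw [HypPlane.pseudoDist_eq_max (sub_ne_zero.1 (hne n hn)), hlog n hn, im_p, log_Xpow,
    max_eq_left (a := 2 * log ((p k).re - z.re)) (b := 2 * t n) (by linarith)]
  ring

/-- The real parts differ by `X^(t (n + 1))`, so the maximum is `2 * t n` and the distance is `t n -
t (n + 1)`. The right-hand side is written in the form of the geometric Cauchy criterion. -/
theorem pseudoDist_p_succ (n : ℕ) : (p n).pseudoDist (p (n + 1)) = 1 / 2 / 2 ^ n := by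
  have hre : (p (n + 1)).re - (p n).re = Xpow (t (n + 1)) := by
    rw [re_p, re_p, Finset.sum_Icc_succ_top (by omega), add_sub_cancel_left]
  have hne : (p (n + 1)).re ≠ (p n).re := by
    rw [← sub_ne_zero, hre]
    exact (Xpow_pos _).ne'
  have ht : t (n + 1) ≤ t n := t_strictAnti.antitone n.le_succ
  rw [HypPlane.pseudoDist_comm, HypPlane.pseudoDist_eq_max hne, hre, im_p, im_p, log_Xpow,
    log_Xpow, max_self, max_eq_right (by linarith)]
  unfold t
  rw [pow_succ]
  field_simp
  ring

theorem dist_proj (z z' : HypPlane) : dist (proj z) (proj z') = (z.pseudoDist z' : ℝ) := rfl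

theorem cauchySeq_proj_p : CauchySeq fun n => proj (p n) := by
  refine cauchySeq_of_le_geometric_two (C := 1) fun n => ?_
  rw [dist_proj, pseudoDist_p_succ]
  push_cast
  exact le_rfl

/-! ### Limits in the completion and rational segments -/

theorem isometry_toSegmentCompletion {T : Type*} [MetricSpace T] :
    Isometry (toSegmentCompletion : T → SegmentCompletion T) :=
  Isometry.of_dist_eq fun x y => UniformSpace.Completion.dist_eq x y

/-- A limit of `π(p_n)` in the completion has positive rational distance to all points of the
tree. -/
theorem exists_rat_dist_eq {x : UniformSpace.Completion BrumfielTree}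
    (hx : Filter.Tendsto (fun n => (proj (p n) : UniformSpace.Completion BrumfielTree))
      Filter.atTop (nhds x)) (y : BrumfielTree) :
    ∃ R : ℚ, 0 < R ∧ dist x (y : UniformSpace.Completion BrumfielTree) = R := by
  obtain ⟨z, rfl⟩ : ∃ z, proj z = y := Quotient.exists_rep y
  obtain ⟨C, k, hC⟩ := exists_pseudoDist_p_eq z
  -- Nonnegativity of the distance at `n = k` gives `C ≥ t k`, and `t k > -1` makes the inequality
  -- strict.
  have hpos : 0 < C + 1 := by
    have h := HypPlane.pseudoDist_nonneg (p k) z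
    rw [hC k le_rfl] at h
    linarith [neg_one_lt_t k]
  refine ⟨C + 1, hpos, tendsto_nhds_unique (hx.dist tendsto_const_nhds) ?_⟩
  have h : Filter.Tendsto (fun n => (C : ℝ) - t n) Filter.atTop (nhds ((C : ℝ) - -1)) :=
    tendsto_t.const_sub _
  rw [sub_neg_eq_add] at h
  push_cast
  refine h.congr' ?_
  filter_upwards [Filter.eventually_ge_atTop k] with n hn
  rw [UniformSpace.Completion.dist_eq, dist_proj, hC n hn]
  push_cast
  rfl

/-- A point in the completion of a rational segment that has rational distance to all points of the
segment lies on the segment. -/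
theorem IsRatSegment.exists_eq_of_mem_completedSubset {T : Type*} [MetricSpace T] {s : Set T}
    (hs : IsRatSegment s) {x : UniformSpace.Completion T} (hx : x ∈ completedSubset s)
    (hrat : ∀ y ∈ s, ∃ R : ℚ, dist x (y : UniformSpace.Completion T) = R) :
    ∃ y ∈ s, x = (y : UniformSpace.Completion T) := by
  obtain ⟨a, b, hab, φ, hφ, rfl⟩ := hs
  rw [completedSubset_eq_closure, Metric.mem_closure_iff] at hx
  obtain ⟨R, hR⟩ := hrat _ ⟨⟨a, le_rfl, hab⟩, rfl⟩
  have hR0 : 0 ≤ R := by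
    have : (0 : ℝ) ≤ R := hR ▸ dist_nonneg
    exact_mod_cast this
  have hdist : ∀ u v : Set.Icc a b, dist (φ u : UniformSpace.Completion T) (φ v) =
      |((u : ℚ) : ℝ) - ((v : ℚ) : ℝ)| := fun u v => by
    rw [UniformSpace.Completion.dist_eq, hφ.dist_eq]
    rfl
  -- The distance from `φ a` to `φ u` is `u - a`, and the distance from `φ a` to `x` is `R`. By the
  -- triangle inequality, if `φ u` is close to `x` then `u` is close to `a + R`.
  have happrox : ∀ ε : ℝ, 0 < ε → ∃ u : Set.Icc a b,
      dist x (φ u : UniformSpace.Completion T) < ε ∧ |((u : ℚ) : ℝ) - ((a + R : ℚ) : ℝ)| < ε := by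
    intro ε hε
    obtain ⟨_, ⟨_, ⟨u, rfl⟩, rfl⟩, hu⟩ := hx ε hε
    refine ⟨u, hu, ?_⟩
    have h1 := abs_dist_sub_le (φ u : UniformSpace.Completion T) x (φ ⟨a, le_rfl, hab⟩)
    have h2 : (a : ℝ) ≤ (u : ℚ) := by exact_mod_cast u.2.1
    rw [hdist, hR, dist_comm, abs_of_nonneg (a := ((u : ℚ) : ℝ) - a) (sub_nonneg.2 h2)] at h1
    push_cast
    rw [← sub_sub]
    exact h1.trans_lt hu
  have hb : a + R ≤ b := by
    have : ((a + R : ℚ) : ℝ) ≤ b := le_of_forall_pos_lt_add fun ε hε => by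
      obtain ⟨u, -, hu⟩ := happrox ε hε
      have h1 : ((u : ℚ) : ℝ) ≤ b := by exact_mod_cast u.2.2
      linarith [(abs_lt.1 hu).1]
    exact_mod_cast this
  -- Rationality of `R` is what makes `a + R` a parameter of the segment.
  let v : Set.Icc a b := ⟨a + R, le_add_of_nonneg_right hR0, hb⟩
  refine ⟨φ v, ⟨v, rfl⟩, eq_of_forall_dist_le fun ε hε => ?_⟩
  obtain ⟨u, hu, huv⟩ := happrox (ε / 2) (half_pos hε)
  have h1 := dist_triangle x (φ u : UniformSpace.Completion T) (φ v)
  rw [hdist] at h1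
  change |((u : ℚ) : ℝ) - ((v : ℚ) : ℝ)| < ε / 2 at huv
  linarith

/-- A limit would lie in the completion of some segment and have rational distance to every point of
it. It would then be a point of the tree, at positive distance from itself. -/
theorem not_tendsto_proj_p (x : SegmentCompletion BrumfielTree) :
    ¬ Filter.Tendsto (fun n => toSegmentCompletion (proj (p n))) Filter.atTop (nhds x) := by
  intro h
  have hx : Filter.Tendsto (fun n => (proj (p n) : UniformSpace.Completion BrumfielTree))
      Filter.atTop (nhds x.1) := (continuous_subtype_val.tendsto x).comp h
  obtain ⟨s, hs, hxs⟩ := Set.mem_iUnion₂.1 x.2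
  obtain ⟨y, -, hy⟩ := IsRatSegment.exists_eq_of_mem_completedSubset hs hxs fun y _ => by
    obtain ⟨R, -, hR⟩ := exists_rat_dist_eq hx y
    exact ⟨R, hR⟩
  obtain ⟨R, hR0, hR⟩ := exists_rat_dist_eq hx y
  rw [hy, dist_self] at hR
  exact hR0.ne (by exact_mod_cast hR)

end Puiseux

theorem theorem1p1 :
    -- the segment completion of the tree is not metrically complete
    ¬ CompleteSpace (Puiseux.SegmentCompletion Puiseux.BrumfielTree) ∧
    -- the points `π(p_n)` form a Cauchy sequence in the tree
    CauchySeq (fun n : ℕ => Puiseux.proj (Puiseux.p n)) ∧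
    -- and this sequence has no limit in the segment completion
    ¬ ∃ x : Puiseux.SegmentCompletion Puiseux.BrumfielTree,
      Filter.Tendsto (fun n : ℕ => Puiseux.toSegmentCompletion (Puiseux.proj (Puiseux.p n)))
        Filter.atTop (nhds x) := by
  refine ⟨fun _ => ?_, Puiseux.cauchySeq_proj_p, fun ⟨x, hx⟩ => Puiseux.not_tendsto_proj_p x hx⟩
  -- Being isometric, the embedding of the tree preserves the Cauchy property, so completeness would
  -- produce a forbidden limit.
  obtain ⟨x, hx⟩ := cauchySeq_tendsto_of_complete
    (Puiseux.isometry_toSegmentCompletion.uniformContinuous.comp_cauchySeq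
      Puiseux.cauchySeq_proj_p)
  exact Puiseux.not_tendsto_proj_p x hx
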